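/- Let $n\le m$ be natural numbers. For a finite knot partition $\kappa=\{\kappa_0\le\dots\le\kappa_L\}$ let $N^d_{i,\kappa}$ be the normalized B-spline basis functions of degree $d$, given by the recursion $$N^d_{i,\kappa}(t)=\frac{t-\kappa_i}{\kappa_{i+d}-\kappa_i}N^{d-1}_{i,\kappa}(t)+\frac{\kappa_{i+d+1}-t}{\kappa_{i+d+1}-\kappa_{i+1}}N^{d-1}_{i+1,\kappa}(t)\qquad(\text{with } 0/0=0),$$ where $N^0_{i,\kappa}$ is the indicator function of $[\kappa_i,\kappa_{i+1})$, except that the last non-degenerate knot interval is taken closed, so that at the last knot every B-spline takes its limit from the left. Write $\langle a\rangle^k$ for the knot $a$ repeated $k$ times. Let $\mu=\{t_0\le\dots\le t_{m+n+1}\}=\{\langle t_n\rangle^{n+1},t_{n+1},\dots,t_m,\langle t_{m+1}\rangle^{n+1}\}$ with $t_n<t_{m+1}$ (the interior knots may be repeated), put $I=[t_n,t_{m+1}]$, and let $\mathbf z(t)=\sum_{i=0}^m \mathbf z_iN^n_{i,\mu}(t)$, $t\in I$, be a clamped B-spline with arbitrary $\mathbf z_0,\dots,\mathbf z_m\in\mathbb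 C$. Put $q=2n+(n+1)(m-n)$, $$\nu=\{s_i\}_{i=0,\dots,4n+1+(n+1)(m-n)}=\{\langle t_n\rangle^{2n+1},\langle t_{n+1}\rangle^{n+1},\dots,\langle t_m\rangle^{n+1},\langle t_{m+1}\rangle^{2n+1}\},$$ $$\rho=\{s'_i\}_{i=0,\dots,4n+3+(n+1)(m-n)}=\{\langle t_n\rangle^{2n+2},\langle t_{n+1}\rangle^{n+1},\dots,\langle t_m\rangle^{n+1},\langle t_{m+1}\rangle^{2n+2}\}.$$ Then: (a) $\nu$ and $\rho$ are clamped knot partitions for the degrees $2n$ and $2n+1$ respectively. Moreover $s'_i=s_{i-1}$ for $1\le i\le 4n+2+(n+1)(m-n)$, $s'_0=s'_1$, and the last two knots of $\rho$ are equal. (b) $\mathbf z^2$ is integrable on $I$, and there are $\mathbf p_0,\dots,\mathbf p_q\in\mathbb C$ with $\mathbf z^2(t)=\sum_{k=0}^q\mathbf p_kN^{2n}_{k,\nu}(t)$ for all $t\in I$. (c) For all such $\mathbf p_k$, every $\mathbf r_0\in\mathbb C$, and $\mathbf r_{i+1}=\mathbf r_i+\frac{s_{i+2n+1}-s_i}{2n+1}\,\mathbf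 p_i$ ($i=0,\dots,q$), the B-spline $\mathbf r(t)=\sum_{i=0}^{q+1}\mathbf r_iN^{2n+1}_{i,\rho}(t)$ satisfies $\mathbf r(t)=\mathbf r_0+\int_{t_n}^t\mathbf z^2(y)\,dy$ for all $t\in I$. Hence $\mathbf r'=\mathbf z^2$ at every point of $I$ at which $\mathbf z$ is continuous (derivative and continuity relative to $I$). (d) The curve $\mathbf r$ is clamped: $\mathbf r(t_n)=\mathbf r_0$ and $\mathbf r(t_{m+1})=\mathbf r_{q+1}$. Moreover, with one-sided derivatives, $\mathbf r'(t_n)=\frac{2n+1}{s'_{2n+2}-s'_1}(\mathbf r_1-\mathbf r_0)$ if $t_n<t_{n+1}$, and $\mathbf r'(t_{m+1})=\frac{2n+1}{s'_{q+2n+2}-s'_{q+1}}(\mathbf r_{q+1}-\mathbf r_q)$ if $t_m<t_{m+1}$. (e) If $u=\operatorname{Re}\mathbf z$ and $v=\operatorname{Im}\mathbf z$ are non-zero and non-constant on $I$ and have no non-constant spline function of degree at most $n$ over $\mu$ as a common factor (with cofactors that are also splines of degree at most $n$ over $\mu$), then $\mathbf r=x+\mathrm i y$ is a planar Pythagorean-hodograph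 (PH) B-spline curve. This means that on all of $I$, $x'=w(u^2-v^2)$ and $y'=2wuv$ for some degree-$n$ spline functions $u,v,w$ over $\mu$ with $w\neq0$ and $u,v$ as just described. -/

import Mathlib

open MeasureTheory

noncomputable section

/-- The `i`-th normalized B-spline basis function of degree `d` over the finite knot partition
`t 0 ≤ t 1 ≤ … ≤ t L` (values of `t` beyond the index `L` are irrelevant), by the Cox-de Boor
recursion with `0/0 = 0`. The knot intervals are half-open, `[t i, t (i+1))`, except that the last
non-degenerate one also contains the last knot `t L`; thus every B-spline takes at the last knot
its limit from the left. -/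
def bsplineBasis (t : ℕ → ℝ) (L : ℕ) : ℕ → ℕ → ℝ → ℝ
  | 0, i, x =>
      if (t i ≤ x ∧ x < t (i + 1)) ∨ (t i < x ∧ x = t (i + 1) ∧ x = t L) then 1 else 0
  | d + 1, i, x =>
      (x - t i) / (t (i + (d + 1)) - t i) * bsplineBasis t L d i x
        + (t (i + (d + 1) + 1) - x) / (t (i + (d + 1) + 1) - t (i + 1))
            * bsplineBasis t L d (i + 1) x

/-- The B-spline `∑_{i=0}^{p} c i • N_i^d` of degree `d` over the knot partition
`t 0 ≤ … ≤ t (p+d+1)` with control points `c 0, …, c p`. It is used on `[t d, t (p+1)]` only. -/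
def bspline {E : Type*} [AddCommGroup E] [Module ℝ E] (t : ℕ → ℝ) (d p : ℕ) (c : ℕ → E)
    (x : ℝ) : E :=
  ∑ i ∈ Finset.range (p + 1), bsplineBasis t (p + d + 1) d i x • c i

/-- `t 0 ≤ … ≤ t (p+d+1)` is the knot partition of a clamped degree-`d` B-spline with control
points of index `0, …, p`: `t 0 = … = t d` and `t (p+1) = … = t (p+d+1)`. -/
def IsClampedKnots (t : ℕ → ℝ) (d p : ℕ) : Prop :=
  (∀ i, i ≤ p + d → t i ≤ t (i + 1)) ∧
  (∀ i, i ≤ d → t i = t d) ∧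
  (∀ i, p + 1 ≤ i → i ≤ p + d + 1 → t i = t (p + 1))

/-- The finite knot sequence `⟨t n⟩^e, ⟨t (n+1)⟩^k, …, ⟨t m⟩^k, ⟨t (m+1)⟩^e`, where `⟨a⟩^j` is the
knot `a` repeated `j` times. It has the indices `0, …, 2 * e + k * (m - n) - 1`. -/
def repeatedKnots (t : ℕ → ℝ) (n m e k : ℕ) (i : ℕ) : ℝ :=
  if i < e then t n
  else if i < e + k * (m - n) then t (n + 1 + (i - e) / k)
  else t (m + 1)

/-- `f` is constant on `D`. -/
def ConstOn (f : ℝ → ℝ) (D : Set ℝ) : Prop := ∃ a, ∀ x ∈ D, f x = a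

/-- Two functions on `[t n, t (p+1)]` have a non-constant common factor among the spline functions
(of degree at most `n`) over the partition `t 0 ≤ … ≤ t (p+n+1)`. -/
def HasCommonSplineFactor (t : ℕ → ℝ) (n p : ℕ) (U V : ℝ → ℝ) : Prop :=
  ∃ d e e' : ℕ, d ≤ n ∧ e ≤ n ∧ e' ≤ n ∧ ∃ f g h : ℕ → ℝ,
    ¬ ConstOn (bspline t d (p + n - d) f) (Set.Icc (t n) (t (p + 1))) ∧
    ∀ x ∈ Set.Icc (t n) (t (p + 1)),
      U x = bspline t d (p + n - d) f x * bspline t e (p + n - e) g x ∧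
      V x = bspline t d (p + n - d) f x * bspline t e' (p + n - e') h x

/-- The spline functions `u, v` of degree `n` over `t 0 ≤ … ≤ t (p+n+1)`, with the coefficients
`u i, v i`, are non-zero, non-constant and have no non-constant spline as common factor. -/
def IsPHPair (t : ℕ → ℝ) (n p : ℕ) (u v : ℕ → ℝ) : Prop :=
  (∃ x ∈ Set.Icc (t n) (t (p + 1)), bspline t n p u x ≠ 0) ∧
  (∃ x ∈ Set.Icc (t n) (t (p + 1)), bspline t n p v x ≠ 0) ∧
  ¬ ConstOn (bspline t n p u) (Set.Icc (t n) (t (p + 1))) ∧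
  ¬ ConstOn (bspline t n p v) (Set.Icc (t n) (t (p + 1))) ∧
  ¬ HasCommonSplineFactor t n p (bspline t n p u) (bspline t n p v)

/-- `r = x + i y` is a planar Pythagorean-hodograph B-spline curve on `[t n, t (p+1)]`:
`x' = w (u² - v²)` and `y' = 2 w u v` for degree-`n` spline functions `u, v, w` over
`t 0 ≤ … ≤ t (p+n+1)`, with `u, v` as above and `w` non-zero. Derivatives at the two ends of the
interval are one-sided. -/
def IsPHBSplineCurve (t : ℕ → ℝ) (n p : ℕ) (r : ℝ → ℂ) : Prop :=
  ∃ u v w : ℕ → ℝ, IsPHPair t n p u v ∧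
    (∃ x ∈ Set.Icc (t n) (t (p + 1)), bspline t n p w x ≠ 0) ∧
    ∀ x ∈ Set.Icc (t n) (t (p + 1)),
      HasDerivWithinAt (fun y => (r y).re)
        (bspline t n p w x * (bspline t n p u x ^ 2 - bspline t n p v x ^ 2))
        (Set.Icc (t n) (t (p + 1))) x ∧
      HasDerivWithinAt (fun y => (r y).im)
        (2 * bspline t n p w x * bspline t n p u x * bspline t n p v x)
        (Set.Icc (t n) (t (p + 1))) x

end

/-! The proof works with the tail sums `G_i^d = ∑_{j ≥ i} N_j^d` instead of single B-splines. Cox-de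
Boor says that `G_i^(d+1)` is an affine combination of `G_i^d` and `G_(i+1)^d`, and `N_i^d = G_i^d -
G_(i+1)^d` (`bsplineBasis_eq_tailSum_sub`). Its right derivative is `(d+1)/(t_(i+d+1) - t_i) *
N_i^d`, and it is continuous when that width is positive. So integrating `N_i^d` gives a multiple of
the increment of `G_i^(d+1)` (`integral_tailSum_sub`). Abel summation turns a clamped curve into
`c_0 + ∑ G_(i+1) (c_(i+1) - c_i)`. Comparing the two formulas yields exactly the recursion for `r`
(`bspline_eq_integral`).

For the square, B-splines of degree `d` over clamped knots span on `I` the same functions as the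
truncated powers that the knot multiplicities allow. Both inclusions go by induction on `d`, through
integration. A product of two truncated powers expands into truncated powers at the larger knot, and
repeating interior knots `n + 1` times makes these admissible for degree `2n` (`truncPow_mul_mem`,
`exists_bspline_eq_sq`).

The PH property holds with `w = 1`, since `z² = (u² - v²) + 2iuv` and `r' = z²` wherever `z` is
continuous. A discontinuity of `z` requires an interior knot of multiplicity greater than `n`. Then
a step function with values 1 and 2 divides every spline of degree `n`
(`hasCommonSplineFactor_of_knot`), which the hypothesis on `u`, `v` forbids. -/

/-- Partial sums `∑_{j ≥ i} N_j^d` of the B-splines over a monotone knot sequence that is bounded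
by `b`, by their own recursion. -/
noncomputable def tailSum (t : ℕ → ℝ) (b : ℝ) : ℕ → ℕ → ℝ → ℝ
  | 0, i, x => if t i ≤ x ∧ t i < b then 1 else 0
  | d + 1, i, x =>
      (x - t i) / (t (i + (d + 1)) - t i) * tailSum t b d i x
        + (1 - (x - t i) / (t (i + (d + 1)) - t i)) * tailSum t b d (i + 1) x

theorem bsplineBasis_congr {t t' : ℕ → ℝ} {L L' : ℕ} (hL : t L = t' L') (x : ℝ) :
    ∀ (d i i' : ℕ), (∀ j ≤ d + 1, t (i + j) = t' (i' + j)) →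
      bsplineBasis t L d i x = bsplineBasis t' L' d i' x
  | 0, i, i', h => by
      have h0 := h 0 (by simp)
      have h1 := h 1 (by simp)
      simp only [add_zero] at h0
      simp only [bsplineBasis, h0, h1, hL]
  | d + 1, i, i', h => by
      have h0 := h 0 (by simp)
      have h1 := h 1 (by simp)
      have h2 := h (d + 1) (by simp)
      have h3 := h (d + 2) (by simp)
      simp only [add_zero] at h0
      have e : ∀ k : ℕ, k + (d + 1) + 1 = k + (d + 2) := fun k => by ring
      rw [bsplineBasis, bsplineBasis, bsplineBasis_congr hL x d i i' fun j hj => h j (by omega),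
        bsplineBasis_congr hL x d (i + 1) (i' + 1) fun j hj => by
          simpa only [add_assoc, add_comm 1 j] using h (j + 1) (by omega),
        e, e, h0, h1, h2, h3]

/-! ### Tail sums: values, right derivatives, continuity and integrals. -/

section tailSum

variable {t : ℕ → ℝ} {b : ℝ}

/-- With `0/0 = 0` the weights of a collapsed support are 0 and 1, so the recursion passes to index
`i + 1` at the same knot and ends in the degree-0 step. -/
theorem tailSum_of_eq (ht : Monotone t) {d i : ℕ} (h : t (i + d) = t i) (x : ℝ) :
    tailSum t b d i x = if t i ≤ x ∧ t i < b then 1 else 0 := by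
  induction d generalizing i with
  | zero => rfl
  | succ d ih =>
    have h1 : t (i + 1) = t i :=
      le_antisymm (h ▸ ht (by omega)) (ht (by omega))
    have h2 : t (i + 1 + d) = t (i + 1) := by
      rw [h1, ← h]; congr 1; omega
    rw [tailSum, ih h2, h, h1]
    simp

theorem tailSum_eq_zero_of_lt (ht : Monotone t) {d i : ℕ} {x : ℝ} (h : x < t i) :
    tailSum t b d i x = 0 := by
  induction d generalizing i with
  | zero => rw [tailSum, if_neg (by intro h'; linarith [h'.1])]
  | succ d ih =>
    rw [tailSum, ih h, ih (h.trans_le (ht (by omega)))]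
    simp

theorem tailSum_eq_zero_of_le (ht : Monotone t) {d i : ℕ} (x : ℝ) (h : b ≤ t i) :
    tailSum t b d i x = 0 := by
  induction d generalizing i with
  | zero => rw [tailSum, if_neg (by intro h'; linarith [h'.2])]
  | succ d ih =>
    rw [tailSum, ih h, ih (h.trans (ht (by omega)))]
    simp

/-- The positive width matters only at `x = t i`: a collapsed tail sum already has its jump there.
-/
theorem tailSum_eq_zero (ht : Monotone t) {d i : ℕ} {x : ℝ} (h : x ≤ t i)
    (h' : t i < t (i + d)) : tailSum t b d i x = 0 := by
  rcases h.lt_or_eq with h | rfl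
  · exact tailSum_eq_zero_of_lt ht h
  induction d generalizing i with
  | zero => exact absurd h' (lt_irrefl _)
  | succ d ih =>
    rw [tailSum]
    rcases (ht (Nat.le_succ i) : t i ≤ t (i + 1)).lt_or_eq with h1 | h1
    · rw [tailSum_eq_zero_of_lt (i := i + 1) ht h1]; simp
    · rw [h1, ih (by rw [← h1, add_assoc, add_comm 1 d]; exact h') le_rfl]; simp

theorem tailSum_eq_one (ht : Monotone t) (hb : ∀ i, t i ≤ b) {d i : ℕ} {x : ℝ}
    (h : t (i + d) ≤ x) (hx : x ≤ b) (h' : t i < b) : tailSum t b d i x = 1 := by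
  induction d generalizing i with
  | zero => exact if_pos ⟨h, h'⟩
  | succ d ih =>
    rw [tailSum, ih ((ht (by omega)).trans h) h']
    rcases (hb (i + 1)).lt_or_eq with h1 | h1
    · rw [ih (by rwa [add_assoc, add_comm 1 d]) h1]; ring
    -- Here the tail sum at `i + 1` vanishes instead of being 1, but `x = b` gives it weight 0.
    · have h2 : t (i + (d + 1)) = b := le_antisymm (hb _) (h1 ▸ ht (by omega))
      have h3 : x = b := le_antisymm hx (h2 ▸ h)
      rw [h2, h3, div_self (by linarith)]; ring

/-- The second Cox-de Boor weight of index `i` is one minus the first weight of index `i + 1`, so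
differences of tail sums obey the same recursion. The condition `t i < b` in degree 0 encodes the
closed last interval. -/
theorem bsplineBasis_eq_tailSum_sub (ht : Monotone t) (hb : ∀ i, t i ≤ b) {L : ℕ} (hL : t L = b)
    {x : ℝ} (hx : x ≤ b) (d i : ℕ) :
    bsplineBasis t L d i x = tailSum t b d i x - tailSum t b d (i + 1) x := by
  induction d generalizing i with
  | zero =>
    have h1 : t i ≤ t (i + 1) := ht (Nat.le_succ i)
    have h2 := hb (i + 1)
    simp only [bsplineBasis, tailSum, hL]
    by_cases c1 : t i ≤ x <;> by_cases c2 : t i < b <;> by_cases c3 : t (i + 1) ≤ x <;>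
      by_cases c4 : t (i + 1) < b <;> grind
  | succ d ih =>
    rw [bsplineBasis, tailSum, tailSum, ih, ih]
    have e : i + 1 + (d + 1) = i + (d + 1) + 1 := by ring
    rw [e]
    -- If this width is zero, the two weights do not add up to 1, but they multiply a difference of
    -- tail sums that vanishes.
    by_cases h : t (i + (d + 1) + 1) = t (i + 1)
    · have h1 : tailSum t b d (i + 1) x = tailSum t b d (i + 1 + 1) x := by
        have h2 : t (i + 1 + 1) = t (i + 1) :=
          le_antisymm (h ▸ ht (by omega)) (ht (by omega))
        have h3 : t (i + 1 + d) = t (i + 1) :=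
          le_antisymm (h ▸ ht (by omega)) (ht (by omega))
        rw [tailSum_of_eq ht h3, tailSum_of_eq ht (i := i + 1 + 1), h2]
        rw [h2, ← h]; congr 1; omega
      rw [h1]; ring
    · have h1 : t (i + (d + 1) + 1) - t (i + 1) ≠ 0 := sub_ne_zero.2 h
      have h2 : 1 - (x - t (i + 1)) / (t (i + (d + 1) + 1) - t (i + 1))
          = (t (i + (d + 1) + 1) - x) / (t (i + (d + 1) + 1) - t (i + 1)) := by
        field_simp; ring
      rw [h2]
      have h3 : (x - t (i + 1)) / (t (i + (d + 1) + 1) - t (i + 1))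
        = 1 - (t (i + (d + 1) + 1) - x) / (t (i + (d + 1) + 1) - t (i + 1)) := by rw [← h2]; ring
      rw [h3]; ring

theorem hasDerivWithinAt_tailSum_zero (i : ℕ) (x : ℝ) :
    HasDerivWithinAt (tailSum t b 0 i) 0 (Set.Ioi x) x := by
  by_cases h : t i ≤ x
  · refine (hasDerivWithinAt_const x _ (tailSum t b 0 i x)).congr (fun y hy => ?_) rfl
    have : t i ≤ y := h.trans (le_of_lt hy)
    simp [tailSum, h, this]
  · push Not at h
    refine (hasDerivWithinAt_const x _ (0 : ℝ)).congr_of_eventuallyEq ?_ ?_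
    · filter_upwards [mem_nhdsWithin_of_mem_nhds (Iio_mem_nhds h)] with y hy
      simp only [tailSum]
      exact if_neg fun h' => absurd h'.1 (not_le.2 hy)
    · simp only [tailSum]
      exact if_neg fun h' => absurd h'.1 (not_le.2 h)

theorem hasDerivWithinAt_tailSum_succ {d i : ℕ} {x A B : ℝ}
    (hA : HasDerivWithinAt (tailSum t b d i) A (Set.Ioi x) x)
    (hB : HasDerivWithinAt (tailSum t b d (i + 1)) B (Set.Ioi x) x) :
    HasDerivWithinAt (tailSum t b (d + 1) i)
      (1 / (t (i + (d + 1)) - t i) * (tailSum t b d i x - tailSum t b d (i + 1) x)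
        + ((x - t i) / (t (i + (d + 1)) - t i) * A
          + (1 - (x - t i) / (t (i + (d + 1)) - t i)) * B)) (Set.Ioi x) x := by
  have hw : ∀ c e : ℝ, HasDerivWithinAt (fun y : ℝ => (y - c) / e) (1 / e) (Set.Ioi x) x :=
    fun c e => ((hasDerivAt_id x).sub_const c |>.div_const e).hasDerivWithinAt
  have h1 := ((hw (t i) (t (i + (d + 1)) - t i)).mul hA).add
    (((hw (t i) (t (i + (d + 1)) - t i)).const_sub 1).mul hB)
  refine h1.congr_deriv ?_
  ring

/-- One-sided derivatives make the formula valid at the knots too, whatever their multiplicity. -/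
theorem hasDerivWithinAt_tailSum (ht : Monotone t) (d i : ℕ) (x : ℝ) :
    HasDerivWithinAt (tailSum t b (d + 1) i)
      ((d + 1) / (t (i + (d + 1)) - t i) * (tailSum t b d i x - tailSum t b d (i + 1) x))
      (Set.Ioi x) x := by
  induction d generalizing i with
  | zero =>
    refine (hasDerivWithinAt_tailSum_succ (hasDerivWithinAt_tailSum_zero _ _)
      (hasDerivWithinAt_tailSum_zero _ _)).congr_deriv ?_
    push_cast; ring
  | succ d ih =>
    refine (hasDerivWithinAt_tailSum_succ (ih i) (ih (i + 1))).congr_deriv ?_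
    -- A zero denominator is harmless because the difference it divides is zero as well.
    have hdeg : ∀ j, t (j + (d + 1)) = t j → tailSum t b d j x = tailSum t b d (j + 1) x := by
      intro j hj
      have h1 : t (j + 1) = t j := le_antisymm (hj ▸ ht (by omega)) (ht (by omega))
      have h2 : t (j + d) = t j := le_antisymm (hj ▸ ht (by omega)) (ht (by omega))
      have h3 : t (j + 1 + d) = t (j + 1) := by
        rw [h1, ← hj]; congr 1; omega
      rw [tailSum_of_eq ht h2, tailSum_of_eq ht h3, h1]
    -- One unfolding leaves an identity in the three degree-`d` tail sums `P`, `Q`, `R` below.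
    simp only [tailSum]
    by_cases h0 : t (i + (d + 1 + 1)) = t i
    · simp [h0]
      have h1 : t (i + 1) = t i := le_antisymm (h0 ▸ ht (by omega)) (ht (by omega))
      have h2 : t (i + 1 + (d + 1)) = t i := by rw [← h0]; congr 1; omega
      simp [h1, h2]
    have e : i + 1 + (d + 1) = i + (d + 1 + 1) := by ring
    have hd := hdeg (i + 1)
    rw [e] at hd ⊢
    have h0' : t (i + (d + 1 + 1)) - t i ≠ 0 := sub_ne_zero.2 h0
    generalize tailSum t b d i x = P at *
    generalize tailSum t b d (i + 1) x = Q at *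
    generalize tailSum t b d (i + 1 + 1) x = R at *
    push_cast
    by_cases h1 : t (i + (d + 1 + 1)) = t (i + 1)
    · rw [hd h1]; ring
    · have h1' : t (i + (d + 1 + 1)) - t (i + 1) ≠ 0 := sub_ne_zero.2 h1
      generalize t (i + (d + 1 + 1)) = T at *
      simp only [div_eq_mul_inv]
      -- The identity holds for every `β`, so this width is allowed to be zero.
      generalize (t (i + (d + 1)) - t i)⁻¹ = β
      field_simp
      ring

theorem continuous_mul_heaviside (c e : ℝ) (p : Prop) [Decidable p] :
    Continuous fun x : ℝ => (x - c) / e * (if c ≤ x ∧ p then 1 else 0) := by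
  by_cases hp : p
  · have : (fun x : ℝ => (x - c) / e * (if c ≤ x ∧ p then 1 else 0)) =
        fun x => max (x - c) 0 / e := by
      funext x
      by_cases h : c ≤ x
      · simp [h, hp]
      · simp [h, max_eq_right (sub_nonpos.2 (le_of_not_ge h))]
    rw [this]; fun_prop
  · simp [hp]; exact continuous_const

/-- Each lower-degree term is continuous by induction or is a step. In the second case its weight
vanishes at the jump: the first weight at `t i`, the second at `t (i + (d + 1))`. -/
theorem continuous_tailSum (ht : Monotone t) {d i : ℕ} (h : t i < t (i + d)) :
    Continuous (tailSum t b d i) := by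
  induction d generalizing i with
  | zero => exact absurd h (lt_irrefl _)
  | succ d ih =>
    have e : i + 1 + d = i + (d + 1) := by ring
    have h0 : t (i + (d + 1)) - t i ≠ 0 := by linarith
    have h1 : Continuous fun x => (x - t i) / (t (i + (d + 1)) - t i) * tailSum t b d i x := by
      rcases (ht (Nat.le_add_right i d)).lt_or_eq with h1 | h1
      · have := ih h1
        fun_prop
      · simp only [tailSum_of_eq ht h1.symm]
        exact continuous_mul_heaviside _ _ _
    have h2 : Continuous fun x =>
        (1 - (x - t i) / (t (i + (d + 1)) - t i)) * tailSum t b d (i + 1) x := by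
      rcases (ht (Nat.le_add_right (i + 1) d)).lt_or_eq with h1 | h1
      · have := ih h1
        fun_prop
      · simp only [tailSum_of_eq ht h1.symm]
        have h3 := (continuous_mul_heaviside (t (i + 1)) (t (i + (d + 1)) - t i)
          (t (i + 1) < b)).neg
        refine h3.congr fun x => ?_
        rw [e] at h1
        rw [h1, one_sub_div h0, Pi.neg_apply]
        ring
    exact h1.add h2

theorem continuousWithinAt_tailSum (ht : Monotone t) (d i : ℕ) (x : ℝ) :
    ContinuousWithinAt (tailSum t b d i) (Set.Ici x) x := by
  rw [← Set.Ioi_insert, continuousWithinAt_insert_self]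
  cases d with
  | zero => exact (hasDerivWithinAt_tailSum_zero i x).continuousWithinAt
  | succ d => exact (hasDerivWithinAt_tailSum ht d i x).continuousWithinAt

theorem continuousAt_tailSum_zero {i : ℕ} {x : ℝ} (h : t i < b → t i ≠ x) :
    ContinuousAt (tailSum t b 0 i) x := by
  have h0 : tailSum t b 0 i = fun y => if t i ≤ y ∧ t i < b then 1 else 0 := rfl
  rw [h0]
  by_cases hi : t i < b
  · rcases (h hi).lt_or_gt with h1 | h1
    · refine (continuousAt_const (y := (1 : ℝ))).congr ?_
      filter_upwards [Ioi_mem_nhds h1] with y hy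
      exact (if_pos ⟨le_of_lt hy, hi⟩).symm
    · refine (continuousAt_const (y := (0 : ℝ))).congr ?_
      filter_upwards [Iio_mem_nhds h1] with y hy
      exact (if_neg fun h' => absurd h'.1 (not_le.2 hy)).symm
  · simp only [hi, and_false, if_false]
    exact continuousAt_const

theorem continuousAt_tailSum_of_ne {i : ℕ} {x : ℝ} (h : ∀ j, t j < b → t j ≠ x) (d : ℕ) :
    ContinuousAt (tailSum t b d i) x := by
  induction d generalizing i with
  | zero => exact continuousAt_tailSum_zero (h i)
  | succ d ih =>
    have h1 := ih (i := i)
    have h2 := ih (i := i + 1)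
    exact ((by fun_prop : ContinuousAt (fun x => (x - t i) / (t (i + (d + 1)) - t i)) x).mul h1).add
      ((by fun_prop : ContinuousAt (fun x => 1 - (x - t i) / (t (i + (d + 1)) - t i)) x).mul h2)

theorem intervalIntegrable_tailSum (d i : ℕ) (x y : ℝ) :
    IntervalIntegrable (tailSum t b d i) volume x y := by
  induction d generalizing i with
  | zero =>
    have h0 : tailSum t b 0 i = (Set.Ici (t i)).indicator fun _ => if t i < b then (1 : ℝ) else 0 := by
      funext y
      simp only [tailSum, Set.indicator, Set.mem_Ici, ite_and]
    rw [h0, intervalIntegrable_iff]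
    exact ((intervalIntegrable_iff.1 intervalIntegrable_const).indicator measurableSet_Ici)
  | succ d ih =>
    exact ((ih i).continuousOn_mul (by fun_prop)).add ((ih (i + 1)).continuousOn_mul (by fun_prop))

/-- For positive width this is the fundamental theorem of calculus for a continuous function with an
integrable right derivative. For zero width both sides vanish. -/
theorem integral_tailSum_sub (ht : Monotone t) (d i : ℕ) {x y : ℝ} (hxy : x ≤ y) :
    ∫ u in x..y, (tailSum t b d i u - tailSum t b d (i + 1) u) =
      (t (i + (d + 1)) - t i) / (d + 1)
        * (tailSum t b (d + 1) i y - tailSum t b (d + 1) i x) := by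
  by_cases h : t (i + (d + 1)) = t i
  · have h1 : t (i + 1) = t i := le_antisymm (h ▸ ht (by omega)) (ht (by omega))
    have h2 : t (i + d) = t i := le_antisymm (h ▸ ht (by omega)) (ht (by omega))
    have h3 : t (i + 1 + d) = t (i + 1) := by
      rw [h1, ← h]; congr 1; omega
    simp [tailSum_of_eq ht h2, tailSum_of_eq ht h3, h1, h]
  · have h0 : t (i + (d + 1)) - t i ≠ 0 := sub_ne_zero.2 h
    have hd : (d + 1 : ℝ) ≠ 0 := by positivity
    have hint := (intervalIntegrable_tailSum (t := t) (b := b) d i x y).sub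
      (intervalIntegrable_tailSum (t := t) (b := b) d (i + 1) x y)
    have := intervalIntegral.integral_eq_sub_of_hasDeriv_right_of_le hxy
      (continuous_tailSum (b := b) ht
        (lt_of_le_of_ne (ht (by omega)) (Ne.symm h))).continuousOn
      (fun u _ => hasDerivWithinAt_tailSum ht d i u) (hint.const_mul _)
    rw [← this, intervalIntegral.integral_const_mul]
    field_simp

end tailSum

/-! ### Spans of functions, up to equality on a set -/

/-- The functions that agree on `I` with a linear combination of members of `A`. -/
def spanOn (I : Set ℝ) (A : Set (ℝ → ℝ)) : Submodule ℝ (ℝ → ℝ) :=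
  Submodule.span ℝ (A ∪ {f | Set.EqOn f 0 I})

section spanOn

variable {I : Set ℝ} {A : Set (ℝ → ℝ)} {f g : ℝ → ℝ}

theorem mem_spanOn (hf : f ∈ A) : f ∈ spanOn I A :=
  Submodule.subset_span (Or.inl hf)

theorem mem_spanOn_of_eqOn_zero (hf : Set.EqOn f 0 I) : f ∈ spanOn I A :=
  Submodule.subset_span (Or.inr hf)

theorem mem_spanOn_of_eqOn (hf : f ∈ spanOn I A) (h : Set.EqOn f g I) : g ∈ spanOn I A := by
  have : g - f ∈ spanOn I A := mem_spanOn_of_eqOn_zero fun x hx => by simp [h hx]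
  simpa using add_mem hf this

theorem spanOn_le {S : Submodule ℝ (ℝ → ℝ)} (hA : ∀ f ∈ A, f ∈ S)
    (h0 : ∀ f, Set.EqOn f 0 I → f ∈ S) : spanOn I A ≤ S :=
  Submodule.span_le.2 (Set.union_subset hA h0)

/-- Reduces the degree-raising inductions to generators. Integrability is carried along because
additivity of the integral needs it. -/
theorem integral_mem_of_mem_spanOn {a b : ℝ} (hab : a ≤ b) {B : Set (ℝ → ℝ)}
    (hA : ∀ f ∈ A, IntervalIntegrable f volume a b ∧
      (fun x => ∫ y in a..x, f y) ∈ spanOn (Set.Icc a b) B)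
    (hf : f ∈ spanOn (Set.Icc a b) A) :
    IntervalIntegrable f volume a b ∧ (fun x => ∫ y in a..x, f y) ∈ spanOn (Set.Icc a b) B := by
  have hsub : ∀ x ∈ Set.Icc a b, Set.uIcc a x ⊆ Set.uIcc a b := fun x hx => by
    rw [Set.uIcc_of_le hx.1, Set.uIcc_of_le hab]; exact Set.Icc_subset_Icc_right hx.2
  have hvan : ∀ f : ℝ → ℝ, Set.EqOn f 0 (Set.Icc a b) → IntervalIntegrable f volume a b ∧
      (fun x => ∫ y in a..x, f y) ∈ spanOn (Set.Icc a b) B := fun f hf => by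
    constructor
    · refine (intervalIntegrable_const (c := (0 : ℝ))).congr fun x hx => ?_
      rw [Set.uIoc_of_le hab] at hx
      exact (hf ⟨hx.1.le, hx.2⟩).symm
    · refine mem_spanOn_of_eqOn_zero fun x hx => ?_
      have : ∫ y in a..x, f y = ∫ y in a..x, (0 : ℝ) :=
        intervalIntegral.integral_congr fun y hy =>
          hf (by rw [← Set.uIcc_of_le hab]; exact hsub x hx hy)
      simpa using this
  induction hf using Submodule.span_induction with
  | mem f hf => exact hf.elim (hA f) (hvan f)
  | zero => exact hvan 0 fun _ _ => rfl
  | add f g _ _ hf hg =>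
    refine ⟨hf.1.add hg.1, mem_spanOn_of_eqOn (add_mem hf.2 hg.2) fun x hx => ?_⟩
    exact (intervalIntegral.integral_add (hf.1.mono_set (hsub x hx))
      (hg.1.mono_set (hsub x hx))).symm
  | smul c f _ hf =>
    refine ⟨hf.1.smul c, mem_spanOn_of_eqOn (Submodule.smul_mem _ c hf.2) fun x hx => ?_⟩
    simp [intervalIntegral.integral_const_mul]

end spanOn

/-! ### Truncated powers -/

/-- The truncated power function `x ↦ (x - ξ)₊^e`, right-continuous for `e = 0`. -/
noncomputable def truncPow (ξ : ℝ) (e : ℕ) (x : ℝ) : ℝ := if ξ ≤ x then (x - ξ) ^ e else 0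

theorem continuous_truncPow (ξ : ℝ) (e : ℕ) : Continuous (truncPow ξ (e + 1)) := by
  have : truncPow ξ (e + 1) = fun x => max (x - ξ) 0 ^ (e + 1) := by
    funext x
    by_cases h : ξ ≤ x
    · simp [truncPow, h]
    · simp [truncPow, h, max_eq_right (sub_nonpos.2 (le_of_not_ge h))]
  rw [this]; fun_prop

theorem hasDerivWithinAt_truncPow (ξ : ℝ) (e : ℕ) (x : ℝ) :
    HasDerivWithinAt (truncPow ξ (e + 1)) ((e + 1) * truncPow ξ e x) (Set.Ioi x) x := by
  by_cases h : ξ ≤ x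
  · have h1 : HasDerivAt (fun y : ℝ => (y - ξ) ^ (e + 1)) ((e + 1) * truncPow ξ e x) x := by
      have := ((hasDerivAt_id x).sub_const ξ).pow (e + 1)
      simp only [truncPow, h, if_true]
      refine this.congr_deriv ?_
      simp
    refine h1.hasDerivWithinAt.congr (fun y hy => ?_) ?_
    · exact if_pos (h.trans (le_of_lt hy))
    · exact if_pos h
  · push Not at h
    have h2 : truncPow ξ e x = 0 := if_neg (not_le.2 h)
    rw [h2, mul_zero]
    refine (hasDerivWithinAt_const x _ (0 : ℝ)).congr_of_eventuallyEq ?_ (if_neg (not_le.2 h))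
    filter_upwards [mem_nhdsWithin_of_mem_nhds (Iio_mem_nhds h)] with y hy
    exact if_neg (not_le.2 hy)

theorem intervalIntegrable_truncPow (ξ : ℝ) (e : ℕ) (x y : ℝ) :
    IntervalIntegrable (truncPow ξ e) volume x y := by
  have h0 : truncPow ξ e = (Set.Ici ξ).indicator fun y => (y - ξ) ^ e := by
    funext y
    simp only [truncPow, Set.indicator, Set.mem_Ici]
  rw [h0, intervalIntegrable_iff]
  exact (intervalIntegrable_iff.1
    (Continuous.intervalIntegrable (by fun_prop) _ _)).indicator measurableSet_Ici

theorem integral_truncPow {ξ a x : ℝ} (e : ℕ) (ha : a ≤ ξ) (hx : a ≤ x) :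
    ∫ y in a..x, truncPow ξ e y = (e + 1 : ℝ)⁻¹ * truncPow ξ (e + 1) x := by
  have h := intervalIntegral.integral_eq_sub_of_hasDeriv_right_of_le hx
    (continuous_truncPow ξ e).continuousOn (fun u _ => hasDerivWithinAt_truncPow ξ e u)
    ((intervalIntegrable_truncPow ξ e a x).const_mul _)
  have h0 : truncPow ξ (e + 1) a = 0 := by
    rcases ha.lt_or_eq with h | h
    · exact if_neg (not_le.2 h)
    · simp [truncPow, h]
  have : (e + 1 : ℝ) ≠ 0 := by positivity
  rw [intervalIntegral.integral_const_mul, h0, sub_zero] at h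
  rw [← h]; field_simp

/-- The product lives to the right of the larger knot `η`, where `(x - ξ)^e = ((x - η) + (η - ξ))^e`
expands binomially. -/
theorem truncPow_mul (ξ η : ℝ) (h : ξ ≤ η) (e k : ℕ) :
    truncPow ξ e * truncPow η k =
      ∑ l ∈ Finset.range (e + 1), ((η - ξ) ^ (e - l) * e.choose l) • truncPow η (l + k) := by
  funext x
  simp only [Pi.mul_apply, Finset.sum_apply, Pi.smul_apply, smul_eq_mul]
  by_cases hx : η ≤ x
  · have h1 : (x - ξ) ^ e = ((x - η) + (η - ξ)) ^ e := by ring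
    simp only [truncPow, hx, h.trans hx, if_true]
    rw [h1, add_pow, Finset.sum_mul]
    refine Finset.sum_congr rfl fun l _ => ?_
    ring
  · simp [truncPow, hx]

/-! ### B-splines and admissible truncated powers span the same space -/

/-- The truncated powers of degree at most `d` whose smoothness at their knot is the one that its
multiplicity in `t` prescribes. -/
def truncPows (t : ℕ → ℝ) (b : ℝ) (d : ℕ) : Set (ℝ → ℝ) :=
  {f | ∃ j e, e ≤ d ∧ t (j + (d - e)) = t j ∧ t j < b ∧ f = truncPow (t j) e}

/-- The B-splines of degree `d` over `t`, as differences of tail sums. -/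
def tailSumDiffs (t : ℕ → ℝ) (b : ℝ) (d : ℕ) : Set (ℝ → ℝ) :=
  Set.range fun i x => tailSum t b d i x - tailSum t b d (i + 1) x

section spaces

variable {t : ℕ → ℝ} {a b : ℝ} {D P : ℕ}

/-- Telescoping down from the index `P`, where tail sums vanish. -/
theorem tailSum_mem_spanOn_tailSumDiffs (ht : Monotone t) (hP : t P = b) (d i : ℕ) (I : Set ℝ) :
    tailSum t b d i ∈ spanOn I (tailSumDiffs t b d) := by
  by_cases hi : P ≤ i
  · refine mem_spanOn_of_eqOn_zero fun x _ => tailSum_eq_zero_of_le ht x (hP ▸ ht hi)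
  · push Not at hi
    induction h : P - i generalizing i with
    | zero => omega
    | succ k ih =>
      have h1 : tailSum t b d (i + 1) ∈ spanOn I (tailSumDiffs t b d) := by
        by_cases h2 : P ≤ i + 1
        · exact mem_spanOn_of_eqOn_zero fun x _ => tailSum_eq_zero_of_le ht x (hP ▸ ht h2)
        · exact ih (i + 1) (by omega) (by omega)
      have h2 : (fun x => tailSum t b d i x - tailSum t b d (i + 1) x) ∈ tailSumDiffs t b d := ⟨i, rfl⟩
      refine mem_spanOn_of_eqOn (add_mem (mem_spanOn h2) h1) fun x _ => ?_
      simp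

theorem tailSum_zero_eq_one (ht : Monotone t) (hb : ∀ i, t i ≤ b) (hab : a < b)
    (h0 : ∀ i ≤ D, t i = a) {d : ℕ} (hd : d ≤ D) {x : ℝ} (hx : x ∈ Set.Icc a b) :
    tailSum t b d 0 x = 1 :=
  tailSum_eq_one ht hb (by rw [zero_add, h0 d hd]; exact hx.1) hx.2
    (by rw [h0 0 (Nat.zero_le _)]; exact hab)

theorem const_mem_spanOn_truncPows (hab : a < b) (h0 : ∀ i ≤ D, t i = a) {d : ℕ} (hd : d ≤ D)
    (c : ℝ) : (fun _ => c) ∈ spanOn (Set.Icc a b) (truncPows t b d) := by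
  have h : truncPow (t 0) 0 ∈ truncPows t b d :=
    ⟨0, 0, Nat.zero_le _, by rw [h0 _ (by omega), h0 _ (by omega)],
      by rw [h0 _ (by omega)]; exact hab, rfl⟩
  refine mem_spanOn_of_eqOn (Submodule.smul_mem _ c (mem_spanOn h)) fun x hx => ?_
  have : t 0 ≤ x := by rw [h0 _ (by omega)]; exact hx.1
  simp [truncPow, this]

theorem const_mem_spanOn_tailSumDiffs (ht : Monotone t) (hb : ∀ i, t i ≤ b) (hab : a < b)
    (h0 : ∀ i ≤ D, t i = a) (hP : t P = b) {d : ℕ} (hd : d ≤ D) (c : ℝ) :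
    (fun _ => c) ∈ spanOn (Set.Icc a b) (tailSumDiffs t b d) := by
  refine mem_spanOn_of_eqOn (Submodule.smul_mem _ c
    (tailSum_mem_spanOn_tailSumDiffs ht hP d 0 _)) fun x hx => ?_
  simp [tailSum_zero_eq_one ht hb hab h0 hd hx]

/-- B-splines are piecewise polynomials. -/
theorem tailSum_mem_spanOn_truncPows (ht : Monotone t) (hab : a < b)
    (h0 : ∀ i ≤ D, t i = a) {d : ℕ} (hd : d ≤ D) (i : ℕ) :
    tailSum t b d i ∈ spanOn (Set.Icc a b) (truncPows t b d) := by
  have hdeg : ∀ d i, t (i + d) = t i →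
      tailSum t b d i ∈ spanOn (Set.Icc a b) (truncPows t b d) := by
    intro d i h
    by_cases hi : t i < b
    · refine mem_spanOn ⟨i, 0, Nat.zero_le _, h, hi, ?_⟩
      funext x
      rw [tailSum_of_eq ht h]
      simp [hi, truncPow]
    · exact mem_spanOn_of_eqOn_zero fun x _ => tailSum_eq_zero_of_le ht x (not_lt.1 hi)
  induction d generalizing i with
  | zero => exact hdeg 0 i rfl
  | succ d ih =>
    by_cases h : t (i + (d + 1)) = t i
    · exact hdeg _ _ h
    -- Up to a factor and its value at `a`, the tail sum is the integral of a difference one degree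
    -- lower. Integration raises `e` and `d` together, so the multiplicity condition on `d - e` is
    -- preserved.
    · have h1 := (integral_mem_of_mem_spanOn hab.le (B := truncPows t b (d + 1)) ?_
        (sub_mem (ih (by omega) i) (ih (by omega) (i + 1)))).2
      · have h2 := add_mem (Submodule.smul_mem _ ((d + 1) / (t (i + (d + 1)) - t i)) h1)
          (const_mem_spanOn_truncPows hab h0 hd (tailSum t b (d + 1) i a))
        refine mem_spanOn_of_eqOn h2 fun x hx => ?_
        have h3 := integral_tailSum_sub (b := b) ht d i hx.1
        have h4 : t (i + (d + 1)) - t i ≠ 0 := sub_ne_zero.2 h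
        have h5 : (d + 1 : ℝ) ≠ 0 := by positivity
        simp only [Pi.add_apply, Pi.smul_apply, Pi.sub_apply, smul_eq_mul, h3]
        field_simp
        ring
      · rintro f ⟨j, e, he, hj, hjb, rfl⟩
        refine ⟨intervalIntegrable_truncPow _ _ _ _, ?_⟩
        have h2 : truncPow (t j) (e + 1) ∈ truncPows t b (d + 1) :=
          ⟨j, e + 1, by omega, by rw [← hj]; congr 1; omega, hjb, rfl⟩
        refine mem_spanOn_of_eqOn (Submodule.smul_mem _ (e + 1 : ℝ)⁻¹ (mem_spanOn h2))
          fun x hx => ?_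
        exact (integral_truncPow e (h0 0 (by omega) ▸ ht (Nat.zero_le j)) hx.1).symm

/-- The B-splines span all piecewise polynomials of the prescribed smoothness. -/
theorem truncPow_mem_spanOn_tailSumDiffs (ht : Monotone t) (hb : ∀ i, t i ≤ b) (hab : a < b)
    (h0 : ∀ i ≤ D, t i = a) (hP : t P = b) {d : ℕ} (hd : d ≤ D) {f : ℝ → ℝ}
    (hf : f ∈ truncPows t b d) : f ∈ spanOn (Set.Icc a b) (tailSumDiffs t b d) := by
  induction d generalizing f with
  | zero =>
    obtain ⟨j, e, he, hj, hjb, rfl⟩ := hf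
    obtain rfl : e = 0 := by omega
    refine mem_spanOn_of_eqOn (tailSum_mem_spanOn_tailSumDiffs ht hP 0 j _) fun x _ => ?_
    simp [tailSum, truncPow, hjb]
  | succ d ih =>
    obtain ⟨j, e, he, hj, hjb, rfl⟩ := hf
    cases e with
    | zero =>
      refine mem_spanOn_of_eqOn (tailSum_mem_spanOn_tailSumDiffs ht hP (d + 1) j _) fun x _ => ?_
      rw [tailSum_of_eq (d := d + 1) ht hj]
      simp [truncPow, hjb]
    | succ e =>
      -- The converse integration: the power of exponent `e` is a combination of degree-`d`
      -- B-splines, whose integrals are multiples of tail sums minus constants.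
      have h1 : truncPow (t j) e ∈ truncPows t b d :=
        ⟨j, e, by omega, by rw [← hj]; congr 1; omega, hjb, rfl⟩
      have h2 := (integral_mem_of_mem_spanOn hab.le (B := tailSumDiffs t b (d + 1)) ?_
        (ih (by omega) h1)).2
      · refine mem_spanOn_of_eqOn (Submodule.smul_mem _ (e + 1 : ℝ) h2) fun x hx => ?_
        have h5 : (e + 1 : ℝ) ≠ 0 := by positivity
        simp only [Pi.smul_apply, smul_eq_mul,
          integral_truncPow e (h0 0 (by omega) ▸ ht (Nat.zero_le j)) hx.1]
        field_simp
      · rintro f ⟨i, rfl⟩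
        refine ⟨(intervalIntegrable_tailSum d i a b).sub
          (intervalIntegrable_tailSum d (i + 1) a b), ?_⟩
        refine mem_spanOn_of_eqOn (Submodule.smul_mem _ ((t (i + (d + 1)) - t i) / (d + 1))
          (sub_mem (tailSum_mem_spanOn_tailSumDiffs ht hP (d + 1) i _)
          (const_mem_spanOn_tailSumDiffs ht hb hab h0 hP hd (tailSum t b (d + 1) i a))))
          fun x hx => ?_
        simp only [Pi.smul_apply, Pi.sub_apply, smul_eq_mul, integral_tailSum_sub ht d i hx.1]

theorem exists_eq_sum_of_mem_spanOn (ht : Monotone t) (hP : t (P + 1) = b) {d : ℕ}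
    {I : Set ℝ} {f : ℝ → ℝ} (hf : f ∈ spanOn I (tailSumDiffs t b d)) :
    ∃ c : ℕ → ℝ, ∀ x ∈ I, f x =
      ∑ i ∈ Finset.range (P + 1), c i * (tailSum t b d i x - tailSum t b d (i + 1) x) := by
  induction hf using Submodule.span_induction with
  | mem f hf =>
    rcases hf with ⟨i, rfl⟩ | hf
    · by_cases hi : i < P + 1
      · refine ⟨fun j => if j = i then 1 else 0, fun x _ => ?_⟩
        simp [hi]
      · refine ⟨0, fun x _ => ?_⟩
        have h1 : b ≤ t i := hP ▸ ht (not_lt.1 hi)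
        simp [tailSum_eq_zero_of_le ht x h1,
          tailSum_eq_zero_of_le (i := i + 1) ht x (h1.trans (ht (Nat.le_succ i)))]
    · exact ⟨0, fun x hx => by simp [hf hx]⟩
  | zero => exact ⟨0, fun x hx => by simp⟩
  | add f g _ _ hf hg =>
    obtain ⟨c, hc⟩ := hf
    obtain ⟨e, he⟩ := hg
    refine ⟨c + e, fun x hx => ?_⟩
    simp [hc x hx, he x hx, ← Finset.sum_add_distrib, add_mul]
  | smul k f _ hf =>
    obtain ⟨c, hc⟩ := hf
    refine ⟨fun i => k * c i, fun x hx => ?_⟩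
    simp [hc x hx, Finset.mul_sum, mul_assoc]

end spaces

/-! ### Clamped B-spline curves: Abel summation, end points, integration -/

theorem bspline_congr {E : Type*} [AddCommGroup E] [Module ℝ E] {t t' : ℕ → ℝ} {d p : ℕ}
    (h : ∀ i ≤ p + d + 1, t i = t' i) (c : ℕ → E) : bspline t d p c = bspline t' d p c := by
  funext x
  refine Finset.sum_congr rfl fun i hi => ?_
  rw [Finset.mem_range] at hi
  rw [bsplineBasis_congr (h _ le_rfl) x d i i fun j hj => h _ (by omega)]

theorem tailSum_succ {t t' : ℕ → ℝ} (h : ∀ i, t' (i + 1) = t i) (b : ℝ) (d i : ℕ) :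
    tailSum t' b d (i + 1) = tailSum t b d i := by
  induction d generalizing i with
  | zero => funext x; simp only [tailSum, h]
  | succ d ih =>
    have e : i + 1 + (d + 1) = i + (d + 1) + 1 := by ring
    funext x
    simp only [tailSum, ih, h, e]

section bspline

variable {E : Type*} [AddCommGroup E] [Module ℝ E] {t : ℕ → ℝ} {a b : ℝ} {d p : ℕ}

theorem bspline_eq_sum_tailSum (ht : Monotone t) (hb : ∀ i, t i ≤ b) (hp : t (p + 1) = b)
    (c : ℕ → E) {x : ℝ} (hx : x ≤ b) :
    bspline t d p c x =
      ∑ i ∈ Finset.range (p + 1), (tailSum t b d i x - tailSum t b d (i + 1) x) • c i := by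
  have hL : t (p + d + 1) = b := le_antisymm (hb _) (hp ▸ ht (by omega))
  exact Finset.sum_congr rfl fun i _ => by rw [bsplineBasis_eq_tailSum_sub ht hb hL hx]

theorem sum_range_sub_smul (g : ℕ → ℝ) (c : ℕ → E) (N : ℕ) :
    ∑ i ∈ Finset.range (N + 1), (g i - g (i + 1)) • c i =
      g 0 • c 0 + ∑ i ∈ Finset.range N, g (i + 1) • (c (i + 1) - c i) - g (N + 1) • c N := by
  induction N with
  | zero => simp [sub_smul]
  | succ N ih =>
    rw [Finset.sum_range_succ, ih, Finset.sum_range_succ _ N, sub_smul, smul_sub]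
    abel

/-- Abel summation for a B-spline over a clamped knot sequence. -/
theorem bspline_eq_add_sum (ht : Monotone t) (hb : ∀ i, t i ≤ b) (hab : a < b)
    (h0 : ∀ i ≤ d, t i = a) (hp : t (p + 1) = b) (c : ℕ → E) {x : ℝ} (hx : x ∈ Set.Icc a b) :
    bspline t d p c x =
      c 0 + ∑ i ∈ Finset.range p, tailSum t b d (i + 1) x • (c (i + 1) - c i) := by
  rw [bspline_eq_sum_tailSum ht hb hp c hx.2, sum_range_sub_smul fun i => tailSum t b d i x,
    tailSum_zero_eq_one ht hb hab h0 le_rfl hx, tailSum_eq_zero_of_le (i := p + 1) ht x hp.ge]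
  simp

theorem bspline_one (ht : Monotone t) (hb : ∀ i, t i ≤ b) (hab : a < b)
    (h0 : ∀ i ≤ d, t i = a) (hp : t (p + 1) = b) {x : ℝ} (hx : x ∈ Set.Icc a b) :
    bspline t d p (fun _ => (1 : ℝ)) x = 1 := by
  simp [bspline_eq_add_sum ht hb hab h0 hp _ hx]

theorem bspline_left (ht : Monotone t) (hb : ∀ i, t i ≤ b) (hab : a < b)
    (h0 : ∀ i ≤ d, t i = a) (hp : t (p + 1) = b) (h1 : a < t (d + 1)) (c : ℕ → E) :
    bspline t d p c a = c 0 := by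
  rw [bspline_eq_add_sum ht hb hab h0 hp c (Set.left_mem_Icc.2 hab.le), Finset.sum_eq_zero]
  · simp
  · intro i _
    have ha : a ≤ t (i + 1) := h0 0 (Nat.zero_le _) ▸ ht (Nat.zero_le _)
    rcases ha.lt_or_eq with h | h
    · rw [tailSum_eq_zero_of_lt ht h, zero_smul]
    · rw [tailSum_eq_zero ht ha (h ▸ h1.trans_le (ht (by omega))), zero_smul]

theorem bspline_right (ht : Monotone t) (hb : ∀ i, t i ≤ b) (hab : a < b)
    (h0 : ∀ i ≤ d, t i = a) (hp : t (p + 1) = b) (h1 : t p < b) (c : ℕ → E) :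
    bspline t d p c b = c p := by
  rw [bspline_eq_add_sum ht hb hab h0 hp c (Set.right_mem_Icc.2 hab.le),
    Finset.sum_congr rfl (g := fun i => c (i + 1) - c i), Finset.sum_range_sub]
  · abel
  · intro i hi
    rw [Finset.mem_range] at hi
    rw [tailSum_eq_one ht hb (hb _) le_rfl ((ht (by omega)).trans_lt h1), one_smul]

theorem continuousWithinAt_bspline_left (ht : Monotone t) (hb : ∀ i, t i ≤ b) (hab : a < b)
    (hp : t (p + 1) = b) (c : ℕ → ℂ) :
    ContinuousWithinAt (bspline t d p c) (Set.Icc a b) a := by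
  have h : ContinuousWithinAt (fun x => ∑ i ∈ Finset.range (p + 1),
      (tailSum t b d i x - tailSum t b d (i + 1) x) • c i) (Set.Icc a b) a :=
    tendsto_finsetSum _ fun i _ =>
      (((continuousWithinAt_tailSum ht d i a).mono Set.Icc_subset_Ici_self).sub
        ((continuousWithinAt_tailSum ht d (i + 1) a).mono Set.Icc_subset_Ici_self)).smul_const _
  exact h.congr (fun x hx => bspline_eq_sum_tailSum ht hb hp c hx.2)
    (bspline_eq_sum_tailSum ht hb hp c hab.le)

theorem continuousWithinAt_bspline_right (ht : Monotone t) (hb : ∀ i, t i ≤ b)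
    (hp : t (p + 1) = b) (c : ℕ → ℂ) :
    ContinuousWithinAt (bspline t d p c) (Set.Icc a b) b := by
  have h : ContinuousWithinAt (fun x => ∑ i ∈ Finset.range (p + 1),
      (tailSum t b d i x - tailSum t b d (i + 1) x) • c i) (Set.Icc a b) b :=
    tendsto_finsetSum _ fun i _ => ((continuousAt_tailSum_of_ne (fun j hj => hj.ne) d).sub
      (continuousAt_tailSum_of_ne (fun j hj => hj.ne) d)).continuousWithinAt.smul_const _
  exact h.congr (fun x hx => bspline_eq_sum_tailSum ht hb hp c hx.2)
    (bspline_eq_sum_tailSum ht hb hp c le_rfl)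

theorem intervalIntegrable_tailSum_sub_smul (d i : ℕ) (x y : ℝ) (c : ℂ) :
    IntervalIntegrable (fun u => (tailSum t b d i u - tailSum t b d (i + 1) u) • c)
      volume x y := by
  have h := (intervalIntegrable_tailSum (t := t) (b := b) d i x y).sub
    (intervalIntegrable_tailSum (t := t) (b := b) d (i + 1) x y)
  exact ⟨h.1.smul_const c, h.2.smul_const c⟩

theorem intervalIntegrable_bspline (ht : Monotone t) (hb : ∀ i, t i ≤ b) (hab : a < b)
    (hp : t (p + 1) = b) (c : ℕ → ℂ) :
    IntervalIntegrable (bspline t d p c) volume a b := by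
  have h : IntervalIntegrable (fun x => ∑ i ∈ Finset.range (p + 1),
      (tailSum t b d i x - tailSum t b d (i + 1) x) • c i) volume a b := by
    have := IntervalIntegrable.sum (μ := volume) (a := a) (b := b) (Finset.range (p + 1))
      (f := fun i x => (tailSum t b d i x - tailSum t b d (i + 1) x) • c i) fun i _ =>
      intervalIntegrable_tailSum_sub_smul d i a b (c i)
    simpa only [Finset.sum_fn] using this
  refine h.congr fun x hx => ?_
  rw [Set.uIoc_of_le hab.le] at hx
  exact (bspline_eq_sum_tailSum ht hb hp c hx.2).symm

/-- Integration of a B-spline raises the degree and the end multiplicities by one. -/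
theorem bspline_eq_integral {t' : ℕ → ℝ} (hs : ∀ i, t' (i + 1) = t i) (ht' : Monotone t')
    (hb : ∀ i, t' i ≤ b) (hab : a < b) (h0 : ∀ i ≤ d + 1, t' i = a) (hp : t (p + 1) = b)
    (c r : ℕ → ℂ)
    (hr : ∀ i ≤ p, r (i + 1) = r i + (((t (i + d + 1) - t i) / (d + 1) : ℝ) : ℂ) * c i)
    {x : ℝ} (hx : x ∈ Set.Icc a b) :
    bspline t' (d + 1) (p + 1) r x = r 0 + ∫ y in a..x, bspline t d p c y := by
  have ht : Monotone t := fun i j hij => by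
    rw [← hs, ← hs]; exact ht' (by omega)
  have hb' : ∀ i, t i ≤ b := fun i => hs i ▸ hb _
  rw [bspline_eq_add_sum ht' hb hab h0 ((hs _).trans hp) r hx]
  congr 1
  have h1 : ∫ y in a..x, bspline t d p c y = ∫ y in a..x, ∑ i ∈ Finset.range (p + 1),
      (tailSum t b d i y - tailSum t b d (i + 1) y) • c i := by
    refine intervalIntegral.integral_congr fun y hy => ?_
    rw [Set.uIcc_of_le hx.1] at hy
    exact bspline_eq_sum_tailSum ht hb' hp c (hy.2.trans hx.2)
  rw [h1, intervalIntegral.integral_finsetSum fun i _ =>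
      intervalIntegrable_tailSum_sub_smul d i a x (c i)]
  refine Finset.sum_congr rfl fun i hi => ?_
  rw [Finset.mem_range] at hi
  rw [intervalIntegral.integral_smul_const, integral_tailSum_sub ht d i hx.1, hr i (by omega),
    add_sub_cancel_left, tailSum_succ hs]
  -- The contribution of the lower limit drops out: either the width is zero, or the tail sum
  -- vanishes at `a`.
  have h2 : (t (i + (d + 1)) - t i) * tailSum t b (d + 1) i a = 0 := by
    have h3 : a ≤ t i := by
      rw [← hs, ← h0 0 (Nat.zero_le _)]; exact ht' (Nat.zero_le _)
    rcases (ht (Nat.le_add_right i (d + 1))).lt_or_eq with h | h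
    · rw [tailSum_eq_zero ht h3 h, mul_zero]
    · rw [← h]; simp
  have h4 : (t (i + (d + 1)) - t i) / (d + 1)
      * (tailSum t b (d + 1) i x - tailSum t b (d + 1) i a)
      = tailSum t b (d + 1) i x * ((t (i + (d + 1)) - t i) / (d + 1)) := by
    rw [mul_sub, div_mul_eq_mul_div _ _ (tailSum t b (d + 1) i a), h2]; ring
  rw [h4, Complex.real_smul, Complex.real_smul, Complex.ofReal_mul, mul_assoc, ← add_assoc]

theorem re_bspline (c : ℕ → ℂ) (x : ℝ) :
    (bspline t d p c x).re = bspline t d p (fun i => (c i).re) x := by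
  simp [bspline, Complex.re_sum]

theorem im_bspline (c : ℕ → ℂ) (x : ℝ) :
    (bspline t d p c x).im = bspline t d p (fun i => (c i).im) x := by
  simp [bspline, Complex.im_sum]

end bspline

/-! ### Repeated knots and the square of a B-spline -/

section repeatedKnots

variable {t : ℕ → ℝ} {n m : ℕ}

theorem repeatedKnots_of_lt {e k i : ℕ} (h : i < e) : repeatedKnots t n m e k i = t n :=
  if_pos h

theorem repeatedKnots_of_ge {e k i : ℕ} (h : e + k * (m - n) ≤ i) :
    repeatedKnots t n m e k i = t (m + 1) := by
  rw [repeatedKnots, if_neg (by omega), if_neg (by omega)]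

theorem repeatedKnots_block {e k i l : ℕ} (hi : i < m - n) (hl : l < k) :
    repeatedKnots t n m e k (e + (k * i + l)) = t (n + 1 + i) := by
  have h1 : k * (i + 1) ≤ k * (m - n) := Nat.mul_le_mul_left k hi
  rw [mul_add] at h1
  rw [repeatedKnots, if_neg (by omega), if_pos (by omega), Nat.add_sub_cancel_left,
    Nat.mul_add_div (by omega), Nat.div_eq_of_lt hl, add_zero]

theorem repeatedKnots_succ (e k i : ℕ) :
    repeatedKnots t n m (e + 1) k (i + 1) = repeatedKnots t n m e k i := by
  have h1 : i + 1 < e + 1 + k * (m - n) ↔ i < e + k * (m - n) := by omega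
  simp only [repeatedKnots, Nat.add_lt_add_iff_right, h1, Nat.add_sub_add_right]

theorem repeatedKnots_monotone (hnm : n ≤ m) (ht : ∀ i, n ≤ i → i ≤ m → t i ≤ t (i + 1))
    (e k : ℕ) : Monotone (repeatedKnots t n m e k) := by
  have hmono : ∀ i j, n ≤ i → i ≤ j → j ≤ m + 1 → t i ≤ t j := by
    intro i j hi hij hj
    induction j, hij using Nat.le_induction with
    | base => exact le_rfl
    | succ j hij ih => exact (ih (by omega)).trans (ht j (by omega) (by omega))
  intro i j hij
  have h1 : i < e + k * (m - n) → e ≤ i → (i - e) / k < m - n := fun h h' =>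
    Nat.div_lt_of_lt_mul (by omega)
  have h2 : j < e + k * (m - n) → e ≤ j → (j - e) / k < m - n := fun h h' =>
    Nat.div_lt_of_lt_mul (by omega)
  have h3 : (i - e) / k ≤ (j - e) / k := Nat.div_le_div_right (by omega)
  simp only [repeatedKnots]
  generalize (i - e) / k = u at *
  generalize (j - e) / k = v at *
  generalize k * (m - n) = w at *
  split_ifs <;> first | omega | exact hmono _ _ (by omega) (by omega) (by omega)

theorem repeatedKnots_le (hnm : n ≤ m) (ht : ∀ i, n ≤ i → i ≤ m → t i ≤ t (i + 1))
    (e k i : ℕ) : repeatedKnots t n m e k i ≤ t (m + 1) := by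
  rw [← repeatedKnots_of_ge (t := t) (n := n) (m := m) (e := e) (k := k)
    (i := max i (e + k * (m - n))) (le_max_right _ _)]
  exact repeatedKnots_monotone hnm ht e k (le_max_left _ _)

/-- `t` is unconstrained beyond its last index. This trades it for a sequence that is monotone on
all of `ℕ`, as the tail sum lemmas require. -/
theorem eq_repeatedKnots (ht : IsClampedKnots t n m) {i : ℕ} (hi : i ≤ m + n + 1) :
    t i = repeatedKnots t n m (n + 1) 1 i := by
  obtain ⟨-, h1, h2⟩ := ht
  rw [repeatedKnots]
  split_ifs with h3 h4
  · exact h1 i (by omega)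
  · rw [Nat.div_one]; congr 1; omega
  · exact h2 i (by omega) hi

/-- The products of admissible truncated powers for degree `n` are admissible for degree `2n`,
when the interior knots are repeated `n + 1` times. -/
theorem truncPow_mul_mem (hnm : n ≤ m) (ht : ∀ i, n ≤ i → i ≤ m → t i ≤ t (i + 1)) (I : Set ℝ)
    {f g : ℝ → ℝ}
    (hf : f ∈ truncPows (repeatedKnots t n m (n + 1) 1) (t (m + 1)) n)
    (hg : g ∈ truncPows (repeatedKnots t n m (n + 1) 1) (t (m + 1)) n) :
    f * g ∈ spanOn I
      (truncPows (repeatedKnots t n m (2 * n + 1) (n + 1)) (t (m + 1)) (2 * n)) := by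
  have hτ := repeatedKnots_monotone hnm ht (n + 1) 1
  have hs := repeatedKnots_monotone hnm ht (2 * n + 1) (n + 1)
  set τ := repeatedKnots t n m (n + 1) 1 with hτdef
  set s := repeatedKnots t n m (2 * n + 1) (n + 1) with hsdef
  have hin : ∀ j, τ j < t (m + 1) → j ≤ m := fun j hj => by
    by_contra h
    exact hj.ne (repeatedKnots_of_ge (by omega))
  have hτt : ∀ j, n < j → j ≤ m → τ j = t j := fun j h1 h2 => by
    have := repeatedKnots_block (t := t) (e := n + 1) (k := 1) (l := 0)
      (show j - (n + 1) < m - n by omega) one_pos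
    rw [show n + 1 + (1 * (j - (n + 1)) + 0) = j by omega,
      show n + 1 + (j - (n + 1)) = j by omega] at this
    exact this
  have key : ∀ j e l, e ≤ n → l ≤ n → τ (j + (n - e)) = τ j → τ j < t (m + 1) →
      truncPow (τ j) (l + e) ∈ truncPows s (t (m + 1)) (2 * n) := by
    intro j e l he hl hj hjb
    suffices h : ∃ J, s J = τ j ∧ s (J + (2 * n - (l + e))) = τ j by
      obtain ⟨J, h1, h2⟩ := h
      exact ⟨J, l + e, by omega, h2.trans h1.symm, h1 ▸ hjb, by rw [h1]⟩
    by_cases hjn : j ≤ n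
    · refine ⟨0, ?_, ?_⟩
      · rw [hsdef, hτdef, repeatedKnots_of_lt (by omega), repeatedKnots_of_lt (by omega)]
      · rw [hsdef, hτdef, repeatedKnots_of_lt (by omega), repeatedKnots_of_lt (by omega)]
    · push Not at hjn
      have hjm := hin j hjb
      have hblock : ∀ j' l, n < j' → j' ≤ m → l ≤ n →
          s (2 * n + 1 + ((n + 1) * (j' - (n + 1)) + l)) = τ j' := by
        intro j' l h1 h2 h3
        rw [hτt j' h1 h2, hsdef, repeatedKnots_block (by omega) (by omega)]
        congr 1; omega
      refine ⟨2 * n + 1 + ((n + 1) * (j - (n + 1)) + 0), hblock j 0 hjn hjm (by omega), ?_⟩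
      -- The exponent `l + e` needs `2n - (l + e) + 1` copies of the knot. If `n ≤ l + e`, one block
      -- of `n + 1` copies suffices. Otherwise `e < n`, so the knot occurs at least twice in `τ`,
      -- and two blocks give `2n + 2` copies.
      by_cases hen : n ≤ l + e
      · rw [show 2 * n + 1 + ((n + 1) * (j - (n + 1)) + 0) + (2 * n - (l + e))
          = 2 * n + 1 + ((n + 1) * (j - (n + 1)) + (2 * n - (l + e))) by omega]
        exact hblock j _ hjn hjm (by omega)
      · have h1 : τ (j + 1) = τ j := le_antisymm (hj ▸ hτ (by omega)) (hτ (by omega))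
        have h2 := hin (j + 1) (h1 ▸ hjb)
        apply le_antisymm
        · rw [← h1, ← hblock (j + 1) n (by omega) h2 le_rfl,
            show j + 1 - (n + 1) = (j - (n + 1)) + 1 by omega, mul_add]
          exact hs (by omega)
        · rw [← hblock j 0 hjn hjm (by omega)]
          exact hs (by omega)
  have main : ∀ i e j k, e ≤ n → k ≤ n → τ i ≤ τ j → τ (j + (n - k)) = τ j → τ j < t (m + 1) →
      truncPow (τ i) e * truncPow (τ j) k ∈ spanOn I (truncPows s (t (m + 1)) (2 * n)) := by
    intro i e j k he hk hij hj hjb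
    rw [truncPow_mul _ _ hij]
    refine sum_mem fun l hl => Submodule.smul_mem _ _ (mem_spanOn (key j k l hk ?_ hj hjb))
    rw [Finset.mem_range] at hl
    omega
  obtain ⟨i, e, he, hi, hib, rfl⟩ := hf
  obtain ⟨j, k, hk, hj, hjb, rfl⟩ := hg
  rcases le_total (τ i) (τ j) with h | h
  · exact main i e j k he hk h hj hjb
  · rw [mul_comm (truncPow _ _)]
    exact main j k i e hk he h hi hib

/-- The square of a degree-`n` B-spline is a B-spline of degree `2n`. -/
theorem exists_bspline_eq_sq (hnm : n ≤ m) (ht : ∀ i, n ≤ i → i ≤ m → t i ≤ t (i + 1))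
    (hlt : t n < t (m + 1)) (z : ℕ → ℂ) :
    ∃ p : ℕ → ℂ, ∀ x ∈ Set.Icc (t n) (t (m + 1)),
      bspline (repeatedKnots t n m (n + 1) 1) n m z x ^ 2 =
        bspline (repeatedKnots t n m (2 * n + 1) (n + 1)) (2 * n) (2 * n + (n + 1) * (m - n)) p x := by
  have hτ := repeatedKnots_monotone hnm ht (n + 1) 1
  have hs := repeatedKnots_monotone hnm ht (2 * n + 1) (n + 1)
  have hτb := repeatedKnots_le hnm ht (n + 1) 1
  have hsb := repeatedKnots_le hnm ht (2 * n + 1) (n + 1)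
  have hτ0 : ∀ i ≤ n, repeatedKnots t n m (n + 1) 1 i = t n :=
    fun i hi => repeatedKnots_of_lt (by omega)
  have hs0 : ∀ i ≤ 2 * n, repeatedKnots t n m (2 * n + 1) (n + 1) i = t n :=
    fun i hi => repeatedKnots_of_lt (by omega)
  have hτ1 : repeatedKnots t n m (n + 1) 1 (m + 1) = t (m + 1) := repeatedKnots_of_ge (by omega)
  have hs1 : repeatedKnots t n m (2 * n + 1) (n + 1) (2 * n + (n + 1) * (m - n) + 1) = t (m + 1) :=
    repeatedKnots_of_ge (by omega)
  have hmul := fun f g hf hg => truncPow_mul_mem (f := f) (g := g) hnm ht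
    (Set.Icc (t n) (t (m + 1))) hf hg
  generalize repeatedKnots t n m (n + 1) 1 = τ at *
  generalize repeatedKnots t n m (2 * n + 1) (n + 1) = s at *
  generalize 2 * n + (n + 1) * (m - n) = q at *
  set b := t (m + 1)
  set a := t n
  have hprod : ∀ f g, f ∈ spanOn (Set.Icc a b) (truncPows τ b n) →
      g ∈ spanOn (Set.Icc a b) (truncPows τ b n) →
      f * g ∈ spanOn (Set.Icc a b) (truncPows s b (2 * n)) := by
    intro f g hf hg
    have h := Submodule.mul_mem_mul hf hg
    rw [spanOn, Submodule.span_mul_span] at h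
    refine Submodule.span_le.2 ?_ h
    rintro _ ⟨f, hf, g, hg, rfl⟩
    rcases hf with hf | hf
    · rcases hg with hg | hg
      · exact hmul f g hf hg
      · exact mem_spanOn_of_eqOn_zero fun x hx => by simp [hg hx]
    · exact mem_spanOn_of_eqOn_zero fun x hx => by simp [hf hx]
  have hN : ∀ i, (fun x => tailSum τ b n i x - tailSum τ b n (i + 1) x) ∈
      spanOn (Set.Icc a b) (truncPows τ b n) := fun i =>
    sub_mem (tailSum_mem_spanOn_truncPows hτ hlt hτ0 le_rfl i)
      (tailSum_mem_spanOn_truncPows hτ hlt hτ0 le_rfl (i + 1))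
  have hle : spanOn (Set.Icc a b) (truncPows s b (2 * n)) ≤
      spanOn (Set.Icc a b) (tailSumDiffs s b (2 * n)) :=
    spanOn_le (fun f hf => truncPow_mem_spanOn_tailSumDiffs hs hsb hlt hs0 hs1 le_rfl hf)
      fun f hf => mem_spanOn_of_eqOn_zero hf
  -- Real coefficients for each product of two basis functions; the complex control points then
  -- enter bilinearly.
  choose C hC using fun i j =>
    exists_eq_sum_of_mem_spanOn hs hs1 (hle (hprod _ _ (hN i) (hN j)))
  refine ⟨fun k => ∑ i ∈ Finset.range (m + 1), ∑ j ∈ Finset.range (m + 1), C i j k • (z i * z j),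
    fun x hx => ?_⟩
  rw [bspline_eq_sum_tailSum hτ hτb hτ1 z hx.2, bspline_eq_sum_tailSum hs hsb hs1 _ hx.2, sq,
    Finset.sum_mul_sum]
  simp only [Finset.smul_sum]
  symm
  rw [Finset.sum_comm]
  refine Finset.sum_congr rfl fun i _ => ?_
  rw [Finset.sum_comm]
  refine Finset.sum_congr rfl fun j _ => ?_
  have := hC i j x hx
  simp only [Pi.mul_apply] at this
  rw [smul_mul_smul_comm, this, Finset.sum_smul]
  refine Finset.sum_congr rfl fun k _ => ?_
  rw [smul_smul, mul_comm]

end repeatedKnots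

/-! ### Discontinuities and common factors -/

section commonFactor

variable {t : ℕ → ℝ} {n p : ℕ}

/-- A clamped B-spline of degree `d` is continuous except at interior knots of multiplicity
greater than `d`. -/
theorem exists_knot_of_not_continuousWithinAt {a b : ℝ} {d : ℕ} (ht : Monotone t)
    (hb : ∀ i, t i ≤ b) (hp : t (p + 1) = b) (c : ℕ → ℂ) {x : ℝ} (hx : x ∈ Set.Icc a b)
    (h : ¬ ContinuousWithinAt (bspline t d p c) (Set.Icc a b) x) :
    ∃ i, t i = x ∧ t (i + d) = x ∧ a < x ∧ x < b := by
  by_contra hno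
  push Not at hno
  apply h
  have hG : ∀ i, ContinuousWithinAt (tailSum t b d i) (Set.Icc a b) x := by
    intro i
    rcases (ht (Nat.le_add_right i d)).lt_or_eq with h1 | h1
    · exact (continuous_tailSum ht h1).continuousWithinAt
    · have h2 : tailSum t b d i = tailSum t b 0 i := by
        funext y
        rw [tailSum_of_eq ht h1.symm]; rfl
      rw [h2]
      -- A step that jumps at or before `a` is constant on the interval.
      by_cases h3 : t i ≤ a
      · refine (continuousWithinAt_const (b := if t i < b then (1 : ℝ) else 0)).congr
          (fun y hy => ?_) ?_
        · simp [tailSum, h3.trans hy.1]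
        · simp [tailSum, h3.trans hx.1]
      · refine (continuousAt_tailSum_zero fun h4 h5 => ?_).continuousWithinAt
        rw [← h5] at hno
        exact absurd (hno i rfl h1.symm (not_le.1 h3)) (not_le.2 h4)
  have h : ContinuousWithinAt (fun x => ∑ i ∈ Finset.range (p + 1),
      (tailSum t b d i x - tailSum t b d (i + 1) x) • c i) (Set.Icc a b) x :=
    tendsto_finsetSum _ fun i _ => ((hG i).sub (hG (i + 1))).smul_const _
  exact h.congr (fun x hx => bspline_eq_sum_tailSum ht hb hp c hx.2)
    (bspline_eq_sum_tailSum ht hb hp c hx.2)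

/-- If an interior knot has multiplicity greater than `n`, then a step function that jumps there
is a common factor of all splines of degree `n`. -/
theorem hasCommonSplineFactor_of_knot (ht : Monotone t) (hb : ∀ i, t i ≤ t (p + 1))
    (hab : t n < t (p + 1)) (h0 : ∀ i ≤ n, t i = t n) {i : ℕ} (hi : t (i + n) = t i)
    (hai : t n < t i) (hib : t i < t (p + 1)) (u v : ℕ → ℝ) :
    HasCommonSplineFactor t n p (bspline t n p u) (bspline t n p v) := by
  have hip : i < p + 1 := lt_of_not_ge fun h => absurd (ht h) (not_le.2 hib)
  obtain ⟨k, rfl⟩ : ∃ k, i = k + 1 := ⟨i - 1, by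
    have : i ≠ 0 := by rintro rfl; exact hai.ne' (h0 0 (Nat.zero_le _))
    omega⟩
  -- Two distinct non-zero values: the spline is non-constant, and coefficients can be divided by
  -- it.
  set f : ℕ → ℝ := fun j => if j < k + 1 then 1 else 2 with hf
  have hfx : ∀ x ∈ Set.Icc (t n) (t (p + 1)), bspline t 0 (p + n - 0) f x =
      1 + if t (k + 1) ≤ x then 1 else 0 := by
    intro x hx
    have hd : ∀ j, f (j + 1) - f j = if j = k then 1 else 0 := by
      intro j
      simp only [hf]
      split_ifs <;> first | omega | norm_num
    rw [bspline_eq_add_sum ht hb hab (fun j hj => h0 j (by omega))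
      (le_antisymm (hb _) (ht (by omega))) f hx]
    simp only [hd, smul_eq_mul, mul_ite, mul_one, mul_zero, Finset.sum_ite_eq']
    rw [if_pos (by rw [Finset.mem_range]; omega)]
    simp [tailSum, hib, hf]
  -- By the multiplicity of the knot, every degree-`n` B-spline lives on one side of it, where the
  -- step function equals the constant `f j`.
  have hmul : ∀ c : ℕ → ℝ, ∀ x ∈ Set.Icc (t n) (t (p + 1)), bspline t n p c x =
      bspline t 0 (p + n - 0) f x * bspline t n (p + n - n) (fun j => c j / f j) x := by
    intro c x hx
    rw [hfx x hx, Nat.add_sub_cancel, bspline_eq_sum_tailSum ht hb rfl _ hx.2,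
      bspline_eq_sum_tailSum ht hb rfl _ hx.2, Finset.mul_sum]
    refine Finset.sum_congr rfl fun j _ => ?_
    simp only [smul_eq_mul, hf]
    by_cases hj : j < k + 1
    · by_cases hxk : t (k + 1) ≤ x
      · have h1 : ∀ l ≤ k + 1, tailSum t (t (p + 1)) n l x = 1 := fun l hl =>
          tailSum_eq_one ht hb ((ht (by omega)).trans (hi.le.trans hxk)) hx.2
            ((ht hl).trans_lt hib)
        rw [h1 j (by omega), h1 (j + 1) (by omega)]
        simp
      · simp [hj, hxk]
    · by_cases hxk : t (k + 1) ≤ x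
      · simp [hj, hxk]; ring
      · have h1 : ∀ l, k + 1 ≤ l → tailSum t (t (p + 1)) n l x = 0 := fun l hl =>
          tailSum_eq_zero_of_lt ht ((not_le.1 hxk).trans_le (ht hl))
        rw [h1 j (by omega), h1 (j + 1) (by omega)]
        simp
  refine ⟨0, n, n, Nat.zero_le _, le_rfl, le_rfl, f, fun j => u j / f j, fun j => v j / f j, ?_,
    fun x hx => ⟨hmul u x hx, hmul v x hx⟩⟩
  rintro ⟨A, hA⟩
  have h1 := hA (t n) (Set.left_mem_Icc.2 hab.le)
  have h2 := hA (t (k + 1)) ⟨hai.le, hib.le⟩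
  rw [hfx _ (Set.left_mem_Icc.2 hab.le), if_neg (not_le.2 hai)] at h1
  rw [hfx _ ⟨hai.le, hib.le⟩, if_pos le_rfl] at h2
  linarith

theorem HasCommonSplineFactor.congr {t' : ℕ → ℝ} (h : ∀ i ≤ p + n + 1, t i = t' i)
    {U V : ℝ → ℝ} (hUV : HasCommonSplineFactor t n p U V) : HasCommonSplineFactor t' n p U V := by
  obtain ⟨d, e, e', hd, he, he', f, g, k, h1, h2⟩ := hUV
  have hc : ∀ d ≤ n, ∀ c : ℕ → ℝ, bspline t d (p + n - d) c = bspline t' d (p + n - d) c :=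
    fun d hd c => bspline_congr (fun i hi => h i (by omega)) c
  simp only [hc _ hd, hc _ he, hc _ he', h n (by omega), h (p + 1) (by omega)] at h1 h2
  exact ⟨d, e, e', hd, he, he', f, g, k, h1, h2⟩

end commonFactor

/-! ### Differentiating the integral, and the main theorem -/

theorem hasDerivWithinAt_of_eq_integral {a b : ℝ} {F f : ℝ → ℂ} {c : ℂ}
    (hF : ∀ x ∈ Set.Icc a b, F x = c + ∫ y in a..x, f y) (hf : IntervalIntegrable f volume a b)
    {x : ℝ} (hx : x ∈ Set.Icc a b) (hc : ContinuousWithinAt f (Set.Icc a b) x) :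
    HasDerivWithinAt F (f x) (Set.Icc a b) x := by
  have hab : a ≤ b := hx.1.trans hx.2
  have hfx : IntervalIntegrable f volume a x := hf.mono_set (by
    rw [Set.uIcc_of_le hx.1, Set.uIcc_of_le hab]; exact Set.Icc_subset_Icc_right hx.2)
  have : Fact (x ∈ Set.Icc a b) := ⟨hx⟩
  have h := intervalIntegral.integral_hasDerivWithinAt_right (s := Set.Icc a b)
    (t := Set.Icc a b) hfx ?_ hc
  · exact (h.const_add c).congr hF (hF x hx)
  · refine ⟨Set.Icc a b, self_mem_nhdsWithin, ?_⟩
    rw [intervalIntegrable_iff_integrableOn_Icc_of_le hab] at hf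
    exact hf.aestronglyMeasurable

theorem corollary1 (n m : ℕ) (hnm : n ≤ m) (t : ℕ → ℝ)
    (ht : IsClampedKnots t n m) (hlt : t n < t (m + 1))
    (z : ℕ → ℂ)
    (q : ℕ) (hq : q = 2 * n + (n + 1) * (m - n))
    (s s' : ℕ → ℝ)
    (hs : s = repeatedKnots t n m (2 * n + 1) (n + 1))
    (hs' : s' = repeatedKnots t n m (2 * n + 2) (n + 1)) :
    -- the knot partitions of `z²` and of its integral are clamped, and how they are related
    IsClampedKnots s (2 * n) q ∧
    IsClampedKnots s' (2 * n + 1) (q + 1) ∧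
    (∀ i, 1 ≤ i → i ≤ 4 * n + 2 + (n + 1) * (m - n) → s' i = s (i - 1)) ∧
    s' 0 = s' 1 ∧
    s' (4 * n + 3 + (n + 1) * (m - n)) = s' (4 * n + 2 + (n + 1) * (m - n)) ∧
    -- `z²` is a B-spline of degree `2n` over `s`
    (∃ p : ℕ → ℂ, ∀ x ∈ Set.Icc (t n) (t (m + 1)),
      bspline t n m z x ^ 2 = bspline s (2 * n) q p x) ∧
    IntervalIntegrable (fun x => bspline t n m z x ^ 2) volume (t n) (t (m + 1)) ∧
    -- for all coefficients `p` of `z²` and all `r` given by the recursion (`r 0` is arbitrary)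
    ∀ p : ℕ → ℂ,
      (∀ x ∈ Set.Icc (t n) (t (m + 1)),
        bspline t n m z x ^ 2 = bspline s (2 * n) q p x) →
      ∀ r : ℕ → ℂ,
        (∀ i, i ≤ q →
          r (i + 1) = r i + (((s (i + 2 * n + 1) - s i) / (2 * n + 1) : ℝ) : ℂ) * p i) →
        -- the B-spline of degree `2n+1` over `s'` with control points `r` is the integral of `z²`
        (∀ x ∈ Set.Icc (t n) (t (m + 1)),
          bspline s' (2 * n + 1) (q + 1) r x
            = r 0 + ∫ y in (t n)..x, bspline t n m z y ^ 2) ∧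
        (∀ x ∈ Set.Icc (t n) (t (m + 1)),
          ContinuousWithinAt (bspline t n m z) (Set.Icc (t n) (t (m + 1))) x →
          HasDerivWithinAt (bspline s' (2 * n + 1) (q + 1) r) (bspline t n m z x ^ 2)
            (Set.Icc (t n) (t (m + 1))) x) ∧
        -- it is clamped at both ends
        bspline s' (2 * n + 1) (q + 1) r (t n) = r 0 ∧
        bspline s' (2 * n + 1) (q + 1) r (t (m + 1)) = r (q + 1) ∧
        (t n < t (n + 1) →
          HasDerivWithinAt (bspline s' (2 * n + 1) (q + 1) r)
            ((((2 * n + 1) / (s' (2 * n + 2) - s' 1) : ℝ) : ℂ) * (r 1 - r 0))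
            (Set.Icc (t n) (t (m + 1))) (t n)) ∧
        (t m < t (m + 1) →
          HasDerivWithinAt (bspline s' (2 * n + 1) (q + 1) r)
            ((((2 * n + 1) / (s' (q + 2 * n + 2) - s' (q + 1)) : ℝ) : ℂ) * (r (q + 1) - r q))
            (Set.Icc (t n) (t (m + 1))) (t (m + 1))) ∧
        -- it is a Pythagorean-hodograph B-spline curve, when `Re z` and `Im z` are admissible
        (IsPHPair t n m (fun i => (z i).re) (fun i => (z i).im) →
          IsPHBSplineCurve t n m (bspline s' (2 * n + 1) (q + 1) r)) := by

  have hmono : ∀ i, n ≤ i → i ≤ m → t i ≤ t (i + 1) := fun i _ hi => ht.1 i (by omega)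
  have hτ := repeatedKnots_monotone hnm hmono (n + 1) 1
  have hτb := repeatedKnots_le hnm hmono (n + 1) 1
  have hτt : ∀ i ≤ m + n + 1, t i = repeatedKnots t n m (n + 1) 1 i :=
    fun i hi => eq_repeatedKnots ht hi
  have hτ0 : ∀ i ≤ n, repeatedKnots t n m (n + 1) 1 i = t n :=
    fun i hi => repeatedKnots_of_lt (by omega)
  have hτ1 : repeatedKnots t n m (n + 1) 1 (m + 1) = t (m + 1) := repeatedKnots_of_ge (by omega)
  have hsm := repeatedKnots_monotone hnm hmono (2 * n + 1) (n + 1)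
  have hsb := repeatedKnots_le hnm hmono (2 * n + 1) (n + 1)
  have hsm' := repeatedKnots_monotone hnm hmono (2 * n + 2) (n + 1)
  have hsb' := repeatedKnots_le hnm hmono (2 * n + 2) (n + 1)
  have hsucc := repeatedKnots_succ (t := t) (n := n) (m := m) (2 * n + 1) (n + 1)
  have hs0 : ∀ i ≤ 2 * n, repeatedKnots t n m (2 * n + 1) (n + 1) i = t n :=
    fun i hi => repeatedKnots_of_lt (by omega)
  have hs0' : ∀ i ≤ 2 * n + 1, repeatedKnots t n m (2 * n + 2) (n + 1) i = t n :=
    fun i hi => repeatedKnots_of_lt (by omega)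
  have hs1 : ∀ i, q + 1 ≤ i → repeatedKnots t n m (2 * n + 1) (n + 1) i = t (m + 1) :=
    fun i hi => repeatedKnots_of_ge (by omega)
  have hs1' : ∀ i, q + 2 ≤ i → repeatedKnots t n m (2 * n + 2) (n + 1) i = t (m + 1) :=
    fun i hi => repeatedKnots_of_ge (by omega)
  -- The first knot after the left end block; for `m = n` there are no interior knots and it is the
  -- right end.
  have hsleft : repeatedKnots t n m (2 * n + 1) (n + 1) (2 * n + 1) = t (n + 1) := by
    rcases hnm.lt_or_eq with h | h
    · exact repeatedKnots_block (i := 0) (l := 0) (by omega) (by omega)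
    · rw [repeatedKnots_of_ge (by simp [h]), h]
  have hsright : repeatedKnots t n m (2 * n + 1) (n + 1) q = t m := by
    rcases hnm.lt_or_eq with h | h
    · obtain ⟨k, rfl⟩ := Nat.exists_eq_add_of_lt h
      have := repeatedKnots_block (t := t) (n := n) (m := n + k + 1) (e := 2 * n + 1)
        (k := n + 1) (i := k) (l := n) (by omega) (by omega)
      rw [hq, show n + k + 1 - n = k + 1 by omega, mul_add, mul_one,
        show 2 * n + ((n + 1) * k + (n + 1)) = 2 * n + 1 + ((n + 1) * k + n) by omega, this]
      congr 1; omega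
    · rw [hq, repeatedKnots_of_lt (by simp [h]), h]
  obtain ⟨p₀, hp₀⟩ := exists_bspline_eq_sq hnm hmono hlt z
  have hz : bspline t n m z = bspline (repeatedKnots t n m (n + 1) 1) n m z :=
    bspline_congr hτt z
  rw [← hs, ← hq, ← hz] at hp₀
  have hdisc := fun x hx => exists_knot_of_not_continuousWithinAt (a := t n) (x := x) (d := n) hτ hτb hτ1 z hx
  have hfactor := @fun i => hasCommonSplineFactor_of_knot (i := i) (t := repeatedKnots t n m (n + 1) 1) (n := n)
    (p := m) hτ (by rwa [hτ1]) (by rwa [hτ1, hτ0 n le_rfl]) (by rwa [hτ0 n le_rfl])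
  have hone : ∀ x ∈ Set.Icc (t n) (t (m + 1)), bspline t n m (fun _ => (1 : ℝ)) x = 1 :=
    fun x hx => by
      rw [bspline_congr hτt]; exact bspline_one hτ hτb hlt hτ0 hτ1 hx
  have hcl : ContinuousWithinAt (bspline t n m z) (Set.Icc (t n) (t (m + 1))) (t n) :=
    hz ▸ continuousWithinAt_bspline_left hτ hτb hlt hτ1 z
  have hcr : ContinuousWithinAt (bspline t n m z) (Set.Icc (t n) (t (m + 1))) (t (m + 1)) :=
    hz ▸ continuousWithinAt_bspline_right hτ hτb hτ1 z
  rw [← hz] at hdisc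
  simp only [hτ0 n le_rfl, hτ1] at hfactor
  rw [← hs] at hsm hsb hs0 hs1 hsleft hsright
  rw [← hs'] at hsm' hsb' hs0' hs1'
  replace hsucc : ∀ i, s' (i + 1) = s i := fun i => by rw [hs, hs']; exact hsucc i
  clear hs hs'
  have hleft : t n ∈ Set.Icc (t n) (t (m + 1)) := Set.left_mem_Icc.2 hlt.le
  have hright : t (m + 1) ∈ Set.Icc (t n) (t (m + 1)) := Set.right_mem_Icc.2 hlt.le
  have hint : IntervalIntegrable (fun x => bspline t n m z x ^ 2) volume (t n) (t (m + 1)) := by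
    refine (intervalIntegrable_bspline (d := 2 * n) hsm hsb hlt (hs1 _ le_rfl) p₀).congr fun x hx => ?_
    rw [Set.uIoc_of_le hlt.le] at hx
    exact (hp₀ x ⟨hx.1.le, hx.2⟩).symm
  refine ⟨⟨fun i _ => hsm (Nat.le_succ i), fun i hi => ?_, fun i hi _ => ?_⟩,
    ⟨fun i _ => hsm' (Nat.le_succ i), fun i hi => ?_, fun i hi _ => ?_⟩, fun i hi _ => ?_, ?_, ?_,
    ⟨p₀, hp₀⟩, hint, fun p hp r hr => ?_⟩
  · rw [hs0 i hi, hs0 _ le_rfl]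
  · rw [hs1 i hi, hs1 _ le_rfl]
  · rw [hs0' i hi, hs0' _ le_rfl]
  · rw [hs1' i hi, hs1' _ le_rfl]
  · rw [← hsucc, Nat.sub_add_cancel hi]
  · rw [hs0' 0 (by omega), hs0' 1 (by omega)]
  · rw [hs1' _ (by omega), hs1' _ (by omega)]
  have hF : ∀ x ∈ Set.Icc (t n) (t (m + 1)), bspline s' (2 * n + 1) (q + 1) r x =
      r 0 + ∫ y in (t n)..x, bspline t n m z y ^ 2 := by
    intro x hx
    rw [bspline_eq_integral hsucc hsm' hsb' hlt hs0' (hs1 _ le_rfl) p r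
      (fun i hi => by push_cast at hr ⊢; exact hr i hi) hx]
    congr 1
    refine intervalIntegral.integral_congr fun y hy => ?_
    rw [Set.uIcc_of_le hx.1] at hy
    exact (hp y ⟨hy.1, hy.2.trans hx.2⟩).symm
  have hderiv : ∀ x ∈ Set.Icc (t n) (t (m + 1)),
      ContinuousWithinAt (bspline t n m z) (Set.Icc (t n) (t (m + 1))) x →
      HasDerivWithinAt (bspline s' (2 * n + 1) (q + 1) r) (bspline t n m z x ^ 2)
        (Set.Icc (t n) (t (m + 1))) x :=
    fun x hx hc => hasDerivWithinAt_of_eq_integral hF hint hx (hc.pow 2)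
  have hn : (2 * n + 1 : ℂ) ≠ 0 := by exact_mod_cast Nat.succ_ne_zero (2 * n)
  refine ⟨hF, hderiv, ?_, ?_, fun h => ?_, fun h => ?_, fun hPH => ?_⟩
  · rw [hF _ hleft]; simp
  · rw [bspline_eq_add_sum hsm' hsb' hlt hs0' (hs1' _ le_rfl) r hright,
      Finset.sum_congr rfl (g := fun i => r (i + 1) - r i), Finset.sum_range_sub]
    · abel
    · intro i hi
      rw [Finset.mem_range] at hi
      -- No assumption `t m < t (m + 1)` is needed: if `s i` is already the right end, the recursion
      -- step has width zero and `r (i + 1) = r i`.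
      rcases (hsb i).lt_or_eq with h | h
      · rw [tailSum_eq_one hsm' hsb' (hsb' _) le_rfl (hsucc i ▸ h), one_smul]
      · have h1 : s (i + 2 * n + 1) = t (m + 1) :=
          le_antisymm (hsb _) (h ▸ hsm (by omega))
        rw [hr i (by omega), h1, h]
        simp
  -- The derivative is `z²` at the left end, which equals `p 0` by clamping; the recursion expresses
  -- `p 0` through `r 1 - r 0`.
  · refine (hderiv _ hleft hcl).congr_deriv ?_
    have h1 : ((s (2 * n + 1) : ℂ) - s 0) ≠ 0 := by
      rw [hsleft, hs0 0 (by omega), sub_ne_zero]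
      exact_mod_cast h.ne'
    rw [hp _ hleft, bspline_left hsm hsb hlt hs0 (hs1 _ le_rfl) (by rwa [hsleft]),
      hr 0 (by omega), hsucc, hsucc 0]
    push_cast
    simp only [zero_add]
    field_simp
    ring
  · refine (hderiv _ hright hcr).congr_deriv ?_
    have h1 : ((s (q + 2 * n + 1) : ℂ) - s q) ≠ 0 := by
      rw [hsright, hs1 _ (by omega), sub_ne_zero]
      exact_mod_cast h.ne'
    rw [hp _ hright, bspline_right hsm hsb hlt hs0 (hs1 _ le_rfl) (by rwa [hsright]),
      hr q le_rfl, hsucc, hsucc q]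
    push_cast
    field_simp
    ring
  · refine ⟨fun i => (z i).re, fun i => (z i).im, fun _ => 1, hPH,
      ⟨t n, hleft, by rw [hone _ hleft]; exact one_ne_zero⟩, fun x hx => ?_⟩
    have hcont : ContinuousWithinAt (bspline t n m z) (Set.Icc (t n) (t (m + 1))) x := by
      -- A discontinuity of `z` would produce a common step factor of `u` and `v`.
      by_contra hnc
      obtain ⟨i, h1, h2, h3, h4⟩ := hdisc x hx hnc
      refine hPH.2.2.2.2 ?_
      rw [bspline_congr hτt, bspline_congr hτt]
      exact (hfactor i (h2.trans h1.symm) (h1.symm ▸ h3) (h1.symm ▸ h4) _ _).congr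
        fun i hi => (hτt i hi).symm
    have hd := hderiv x hx hcont
    have hsq : bspline t n m z x ^ 2 = bspline t n m z x * bspline t n m z x := sq _
    rw [hone x hx, ← re_bspline, ← im_bspline]
    constructor
    · refine (Complex.reCLM.hasFDerivAt.comp_hasDerivWithinAt x hd).congr_deriv ?_
      simp only [Complex.reCLM_apply, hsq, Complex.mul_re]
      ring
    · refine (Complex.imCLM.hasFDerivAt.comp_hasDerivWithinAt x hd).congr_deriv ?_
      simp only [Complex.imCLM_apply, hsq, Complex.mul_im]
      ring
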